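/- Let $L$ be a first-order language, $\kappa$ an uncountable cardinal and $M$ a $\kappa$-saturated $L$-structure (for instance, the monster model of a complete theory). Let $A\subseteq M$ with $|A|<\kappa$, let $p(x)$ be a (consistent) partial type over $A$ in a finite tuple of variables $x$, and let $k<\omega$. All sequences are indexed by infinite linear orders and consist of finite tuples of a fixed length. Sequences $(I_i)_i$ are mutually indiscernible over $A$ if each $I_i$ is indiscernible over $A\cup\bigcup_{i'\neq i} I_{i'}$. For a cardinal $\mu$, write $\operatorname{dp-rank}(p)\le\mu$ if for every $c\models p$ and any $1+\mu$ sequences that are mutually indiscernible over $A$, at least one of them is indiscernible over $A\cup c$; write $\operatorname{dp-rank}(p)\ge\mu$ if $\operatorname{dp-rank}(p)\le\nu$ fails for every cardinal $\nu<\mu$. Then the following are equivalent: (i) $\operatorname{dp-rank}(p)\ge k$. (ii) There are an $L$-formula $\varphi(x,y)$, with $y$ a finite tuple of variables, and an $A$-indiscernible sequence $I=(a_j)_{j\in J}$ of tuples of the length of $y$ such that for every set $S\subseteq J$ with exactly $k$ elements there is $c\models p$ with $\{j\in J : M\models\varphi(c,a_j)\}=S$. (iii) There is an $L$-formula $\varphi(x,y)$,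 with $y$ a finite tuple of variables, whose $p$-alternation rank over $A$ is at least $2k$: there are an $A$-indiscernible sequence $(a_j)_{j\in J}$, a realization $c\models p$ and indices $j_0<j_1<\dots<j_{2k}$ in $J$ such that, for each $t<2k$, exactly one of $\varphi(c,a_{j_t})$ and $\varphi(c,a_{j_{t+1}})$ holds in $M$. -/

import Mathlib

open FirstOrder FirstOrder.Language

universe u v w

namespace DpRank

variable (L : FirstOrder.Language.{u, v}) {M : Type w} [L.Structure M]

/-- The tuple `c` realizes the set `p` of formulas with parameters from `A`. -/
def Realizes {A : Set M} {n : ℕ} (p : Set (L[[A]].Formula (Fin n))) (c : Fin n → M) : Prop :=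
  ∀ ψ ∈ p, ψ.Realize c

/-- The set `p` of formulas over `A` is finitely satisfiable in `M`, that is, it is a (consistent)
partial type over `A`, in the finite tuple of variables `x = (x_0, …, x_{n-1})`. -/
def IsPartialType {A : Set M} {n : ℕ} (p : Set (L[[A]].Formula (Fin n))) : Prop :=
  ∀ q : Set (L[[A]].Formula (Fin n)), q ⊆ p → q.Finite → ∃ c : Fin n → M, Realizes L q c

/-- `M` is `κ`-saturated: every partial type in finitely many variables over a set of
fewer than `κ` parameters from `M` is realized in `M`. -/
def IsSaturated (M : Type w) [L.Structure M] (κ : Cardinal.{w}) : Prop :=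
  ∀ A : Set M, Cardinal.mk A < κ → ∀ (n : ℕ) (p : Set (L[[A]].Formula (Fin n))),
    IsPartialType L p → ∃ c : Fin n → M, Realizes L p c

/-- The sequence `(a j)_{j ∈ J}` of `m`-tuples is indiscernible over `B`: any two finite
increasing subsequences of the same length have the same type over `B`. -/
def Indiscernible (B : Set M) {J : Type w} [LinearOrder J] {m : ℕ} (a : J → Fin m → M) : Prop :=
  ∀ (r : ℕ) (s t : Fin r ↪o J) (ψ : L[[B]].Formula (Fin r × Fin m)),
    ψ.Realize (fun v => a (s v.1) v.2) ↔ ψ.Realize (fun v => a (t v.1) v.2)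

/-- The sequences `a i = (a i j)_{j ∈ J i}` of finite tuples are mutually indiscernible over `A`:
each of them is indiscernible over `A` together with all the elements of the others. -/
def MutuallyIndiscernible (A : Set M) {ι : Type w} {J : ι → Type w} [∀ i, LinearOrder (J i)]
    {m : ι → ℕ} (a : ∀ i, J i → Fin (m i) → M) : Prop :=
  ∀ i, Indiscernible L (A ∪ {x | ∃ i', i' ≠ i ∧ ∃ j l, a i' j l = x}) (a i)

/-- `rk-dp(p) ≤ μ`: for every realization `c` of `p` and any `1 + μ` infinite sequences of finite
tuples that are mutually indiscernible over `A`, at least one of the sequences is indiscernible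
over `A ∪ c`. -/
def DpRankLE {A : Set M} {n : ℕ} (p : Set (L[[A]].Formula (Fin n))) (μ : Cardinal.{w}) : Prop :=
  ∀ c : Fin n → M, Realizes L p c →
    ∀ (ι : Type w), Cardinal.mk ι = 1 + μ →
      ∀ (J : ι → Type w) [∀ i, LinearOrder (J i)] [∀ i, Infinite (J i)] (m : ι → ℕ)
        (a : ∀ i, J i → Fin (m i) → M),
        MutuallyIndiscernible L A a → ∃ i, Indiscernible L (A ∪ Set.range c) (a i)

/-- `rk-dp(p) ≥ μ`: the dp-rank of `p`, which is the least `ν` with `rk-dp(p) ≤ ν` (and `∞` if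
there is none), is not smaller than `μ`. -/
def DpRankGE {A : Set M} {n : ℕ} (p : Set (L[[A]].Formula (Fin n))) (μ : Cardinal.{w}) : Prop :=
  ∀ ν < μ, ¬ DpRankLE L p ν

/-- The truth value of `φ(c, y)` has (at least) `k` alternations in the sequence `a`: it changes
at each step along some `j_0 < j_1 < ⋯ < j_k`. -/
def HasAlternations {n m : ℕ} (φ : L.Formula (Fin n ⊕ Fin m)) (c : Fin n → M)
    {J : Type w} [LinearOrder J] (a : J → Fin m → M) (k : ℕ) : Prop :=
  ∃ j : Fin (k + 1) ↪o J, ∀ t : Fin k,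
    (φ.Realize (Sum.elim c (a (j t.castSucc))) ↔ ¬ φ.Realize (Sum.elim c (a (j t.succ))))

/-- The `p`-alternation rank of `φ(x, y)` over `A` is at least `k`: for some infinite
`A`-indiscernible sequence `a` and some realization `c` of `p`, the truth value of `φ(c, y)` has
`k` alternations in `a`. -/
def AltRankGE {A : Set M} {n m : ℕ} (p : Set (L[[A]].Formula (Fin n)))
    (φ : L.Formula (Fin n ⊕ Fin m)) (k : ℕ) : Prop :=
  ∃ (J : Type w) (_ : LinearOrder J) (_ : Infinite J) (a : J → Fin m → M),
    Indiscernible L A a ∧ ∃ c : Fin n → M, Realizes L p c ∧ HasAlternations L φ c a k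

end DpRank

/-! The engine is the reindexing of indiscernibles. A finite mutually indiscernible family is
jointly indiscernible (`MutuallyIndiscernible.sameEM`), so saturation provides a family with the
same Ehrenfeucht–Mostowski type along any countable order (`SameEM.exists_of_countable`), and
`IsSaturated.exists_sameType` carries the realization `c` along. The order used is `ℕ ×ₗ ℕ`, a
sequence of infinite rows.

From (i) to (ii): failure of dp-rank `≤ k - 1` gives `k` mutually indiscernible sequences, none
indiscernible over some `c`. For each one, some condition `E i` on `c` is lost when a single entry
of a tuple moves to the right (`exists_witness_of_not_indiscernible`). Varying that entry alone
gives a sequence of tuples, in which suitable pairs can be chosen so that "`E i` at the first, not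
at the second" singles out one prescribed index (`exists_pairs`). The disjunction over the `k`
sequences cuts out `k` prescribed indices (`exists_definable_selection`).

From (ii) to (iii): cut out every other one of `2 * k + 1` points.

From (iii) to (i): spread the alternating points over `k` rows, two in each. The rows are mutually
indiscernible, and an alternation inside a row prevents its indiscernibility over `c`. -/

namespace DpRank

/-! ### Definable sets and their parameters -/

section Definable

variable {L : FirstOrder.Language.{u, v}} {M : Type w} [L.Structure M]

/-- The set defined by a formula with parameters is definable. -/
lemma definable_setOf_realize {A : Set M} {X : Type*} (ψ : L[[A]].Formula X) :
    A.Definable L {v : X → M | ψ.Realize v} := ⟨ψ, rfl⟩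

/-- The set defined by a formula without parameters is definable over every set. -/
lemma definable_setOf_realize_of_formula (A : Set M) {X : Type*} (ψ : L.Formula X) :
    A.Definable L {v : X → M | ψ.Realize v} :=
  (Set.empty_definable_iff.2 ⟨ψ, rfl⟩).mono (Set.empty_subset A)

/-- Substituting the elements `f y` for the variables `y` turns a set definable over `A` into one
definable over `A` together with these elements. -/
lemma definable_sumElim {A : Set M} {X Y : Type*} (f : Y → M) {D : Set (Y ⊕ X → M)}
    (hD : A.Definable L D) : (A ∪ Set.range f).Definable L {v : X → M | Sum.elim f v ∈ D} := by
  obtain ⟨φ, rfl⟩ := Set.definable_iff_exists_formula_sum.1 hD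
  refine Set.definable_iff_exists_formula_sum.2 ⟨φ.relabel (Sum.elim
    (fun a : A => Sum.inl ⟨a, Or.inl a.2⟩)
    (Sum.elim (fun y => Sum.inl ⟨f y, Or.inr ⟨y, rfl⟩⟩) Sum.inr)), ?_⟩
  ext v
  simp only [Set.mem_ofPred_eq, Formula.realize_relabel]
  apply iff_of_eq
  congr 1
  funext x
  rcases x with a | y | x <;> rfl

/-- Substitution of constants from `B` for some of the variables. -/
lemma definable_subst {A B : Set M} {X Y V : Type*} (f : Y → M) (hf : ∀ y, f y ∈ B)
    (hAB : A ⊆ B) (g : V → Y ⊕ X) {D : Set (V → M)} (hD : A.Definable L D) :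
    B.Definable L {v : X → M | (fun x => Sum.elim f v (g x)) ∈ D} :=
  (definable_sumElim f (hD.preimage_comp g)).mono
    (Set.union_subset hAB (Set.range_subset_iff.2 hf))

/-- A set definable over `A` and the elements `f y` arises by substituting the `f y` for variables
in a set definable over `A`. -/
lemma exists_definable_sumElim {A B : Set M} {X Y : Type*} (f : Y → M)
    (hB : B ⊆ A ∪ Set.range f) {D : Set (X → M)} (hD : B.Definable L D) :
    ∃ D' : Set (Y ⊕ X → M), A.Definable L D' ∧ ∀ v, v ∈ D ↔ Sum.elim f v ∈ D' := by
  classical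
  obtain ⟨φ, rfl⟩ := Set.definable_iff_exists_formula_sum.1 hD
  have h : ∀ b : B, ∃ z : A ⊕ Y, Sum.elim (↑) f z = (b : M) := by
    intro b
    rcases hB b.2 with hb | ⟨y, hy⟩
    · exact ⟨Sum.inl ⟨b, hb⟩, rfl⟩
    · exact ⟨Sum.inr y, hy⟩
  choose z hz using h
  refine ⟨_, Set.definable_iff_exists_formula_sum.2 ⟨φ.relabel (Sum.elim
    (fun b => Sum.elim Sum.inl (fun y => Sum.inr (Sum.inl y)) (z b))
    (fun x => Sum.inr (Sum.inr x))), rfl⟩, fun v => ?_⟩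
  simp only [Set.mem_ofPred_eq, Formula.realize_relabel]
  apply iff_of_eq
  congr 1
  funext x
  rcases x with b | x
  · simp only [Sum.elim_inl, Function.comp_apply, ← hz b]
    rcases z b with a | y <;> rfl
  · rfl

/-- Membership in a definable set depends on finitely many coordinates only. -/
lemma exists_finset_of_definable {A : Set M} {X : Type*} {D : Set (X → M)}
    (hD : A.Definable L D) : ∃ (G : Finset X) (D' : Set (G → M)), A.Definable L D' ∧
      ∀ v, v ∈ D ↔ (fun x : G => v x) ∈ D' := by
  classical
  obtain ⟨φ, rfl⟩ := hD
  refine ⟨φ.freeVarFinset, _, ⟨φ.restrictFreeVar id, rfl⟩, fun v => ?_⟩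
  exact (BoundedFormula.realize_restrictFreeVar (φ := φ) (f := id) (v := fun a => v a) v
    (fun _ => rfl)).symm

/-- A set definable over `A` is defined by a formula with finitely many parameters from `A`. -/
lemma exists_formula_of_definable {A : Set M} {X : Type*} {D : Set (X → M)}
    (hD : A.Definable L D) : ∃ (N : ℕ) (e : Fin N → M) (φ : L.Formula (Fin N ⊕ X)),
      (∀ l, e l ∈ A) ∧ ∀ v, v ∈ D ↔ φ.Realize (Sum.elim e v) := by
  classical
  obtain ⟨A0, hA0, hD0⟩ := Set.definable_iff_finitely_definable.1 hD
  obtain ⟨φ, rfl⟩ := Set.definable_iff_exists_formula_sum.1 hD0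
  let q := A0.equivFin
  refine ⟨_, fun l => (q.symm l : M), φ.relabel (Sum.map q id), fun l => hA0 (q.symm l).2,
    fun v => ?_⟩
  simp only [Set.mem_ofPred_eq, Formula.realize_relabel]
  apply iff_of_eq
  congr 1
  funext x
  rcases x with a | x
  · exact congrArg Subtype.val (q.symm_apply_apply a).symm
  · rfl

end Definable

/-! ### Realizing types of finite and countable tuples -/

section Saturation

variable (L : FirstOrder.Language.{u, v}) {M : Type w} [L.Structure M]

/-- The tuples `v` and `w` have the same type over `A`. -/
def SameType (A : Set M) {X : Type*} (v w : X → M) : Prop :=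
  ∀ D : Set (X → M), A.Definable L D → (v ∈ D ↔ w ∈ D)

variable {L}

/-- It suffices to check one implication, as definable sets are closed under complement. -/
lemma SameType.of_imp {A : Set M} {X : Type*} {v w : X → M}
    (h : ∀ D : Set (X → M), A.Definable L D → v ∈ D → w ∈ D) : SameType L A v w :=
  fun D hD => ⟨h D hD, fun hw => by_contra fun hv => h Dᶜ hD.compl hv hw⟩

lemma SameType.comp {A : Set M} {X Y : Type*} {v w : X → M} (h : SameType L A v w) (f : Y → X) :
    SameType L A (v ∘ f) (w ∘ f) := fun _ hD => h _ (hD.preimage_comp f)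

lemma definable_sInter_of_finite {A : Set M} {X : Type*} {S : Set (Set (X → M))} (hS : S.Finite)
    (h : ∀ G ∈ S, A.Definable L G) : A.Definable L (⋂₀ S) := by
  have := hS.to_subtype
  rw [Set.sInter_eq_iInter]
  exact Set.definable_iInter_of_finite fun G => h G G.2

/-- In a saturated structure, a family of `A`-definable conditions on `(d, c)`, for a countable
tuple `d`, is satisfied by some finite tuple `c` if it is finitely satisfiable. -/
theorem IsSaturated.exists_of_finite_inter {κ : Cardinal.{w}} (hκ : Cardinal.aleph0 < κ)
    (hM : IsSaturated L M κ) {A : Set M} (hA : Cardinal.mk A < κ) {X : Type*} [Countable X]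
    (d : X → M) {n : ℕ} (S : Set (Set (X ⊕ Fin n → M))) (hS : ∀ G ∈ S, A.Definable L G)
    (hfin : ∀ S' ⊆ S, S'.Finite → ∃ c : Fin n → M, ∀ G ∈ S', Sum.elim d c ∈ G) :
    ∃ c : Fin n → M, ∀ G ∈ S, Sum.elim d c ∈ G := by
  -- Uncountability of `κ` allows the countable tuple `d` to be adjoined to the parameters.
  have hB : Cardinal.mk (A ∪ Set.range d : Set M) < κ :=
    (Cardinal.mk_union_le _ _).trans_lt (Cardinal.add_lt_of_lt hκ.le hA
      ((Set.countable_range d).le_aleph0.trans_lt hκ))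
  have key : ∀ G ∈ S, ∃ ψ : L[[(A ∪ Set.range d : Set M)]].Formula (Fin n),
      ∀ c, ψ.Realize c ↔ Sum.elim d c ∈ G := by
    intro G hG
    obtain ⟨ψ, hψ⟩ := definable_sumElim d (hS G hG)
    exact ⟨ψ, fun c => (Set.ext_iff.1 hψ c).symm⟩
  obtain ⟨c, hc⟩ := hM _ hB n {ψ | ∃ G ∈ S, ∀ c, ψ.Realize c ↔ Sum.elim d c ∈ G} (by
    intro q hq hqf
    choose! g hg hg' using hq
    obtain ⟨c, hc⟩ := hfin (g '' q) (Set.image_subset_iff.2 hg) (hqf.image g)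
    exact ⟨c, fun ψ hψ => (hg' hψ c).2 (hc _ (Set.mem_image_of_mem g hψ))⟩)
  refine ⟨c, fun G hG => ?_⟩
  obtain ⟨ψ, hψ⟩ := key G hG
  exact (hψ c).1 (hc ψ ⟨G, hG, hψ⟩)

/-- In a saturated structure, if the countable tuples `v` and `w` have the same type, then for
every `c` there is `c'` such that `(v, c)` and `(w, c')` have the same type. -/
theorem IsSaturated.exists_sameType {κ : Cardinal.{w}} (hκ : Cardinal.aleph0 < κ)
    (hM : IsSaturated L M κ) {A : Set M} (hA : Cardinal.mk A < κ) {X : Type*} [Countable X]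
    {v w : X → M} (h : SameType L A v w) {n : ℕ} (c : Fin n → M) :
    ∃ c' : Fin n → M, SameType L A (Sum.elim v c) (Sum.elim w c') := by
  obtain ⟨c', hc'⟩ := hM.exists_of_finite_inter hκ hA w
    {G : Set (X ⊕ Fin n → M) | A.Definable L G ∧ Sum.elim v c ∈ G} (fun G hG => hG.1) (by
      intro S hS hSf
      obtain ⟨c', hc'⟩ := (h _ (definable_sInter_of_finite hSf
        fun G hG => (hS hG).1).exists_of_finite).1 ⟨c, fun G hG => (hS hG).2⟩
      exact ⟨c', hc'⟩)
  exact ⟨c', SameType.of_imp fun D hD hv => hc' D ⟨hD, hv⟩⟩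

/-- The type of the first `j` members of a sequence given by an ultrafilter on sequences extends
to the next member. -/
lemma IsSaturated.exists_snoc {κ : Cardinal.{w}} (hκ : Cardinal.aleph0 < κ)
    (hM : IsSaturated L M κ) {A : Set M} (hA : Cardinal.mk A < κ) (F : Filter (ℕ → M)) {j : ℕ}
    (d : Fin j → M) (hd : ∀ D : Set (Fin j → M), A.Definable L D →
      (∀ᶠ s in F, (fun i : Fin j => s i) ∈ D) → d ∈ D) :
    ∃ x : M, ∀ D : Set (Fin (j + 1) → M), A.Definable L D →
      (∀ᶠ s in F, (fun i : Fin (j + 1) => s i) ∈ D) → Fin.snoc (α := fun _ => M) d x ∈ D := by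
  obtain ⟨c, hc⟩ := hM.exists_of_finite_inter hκ hA d
    {G : Set (Fin j ⊕ Fin 1 → M) | A.Definable L G ∧
      ∀ᶠ s in F, Sum.elim (fun i : Fin j => s i) (fun _ => s j) ∈ G} (fun G hG => hG.1) (by
      -- Existence of a last entry satisfying the finitely many conditions is itself a definable
      -- property of the first `j` entries. It holds eventually along `F`, hence at `d`.
      intro S hS hSf
      obtain ⟨c', hc'⟩ := hd _ (definable_sInter_of_finite hSf
        fun G hG => (hS hG).1).exists_of_finite (by
          have : ∀ᶠ s in F, ∀ G ∈ S, Sum.elim (fun i : Fin j => s i) (fun _ => s j) ∈ G :=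
            (Filter.eventually_all_finite hSf).2 fun G hG => (hS hG).2
          filter_upwards [this] with s hs
          exact ⟨fun _ => s j, hs⟩)
      exact ⟨c', hc'⟩)
  refine ⟨c 0, fun D hD hev => ?_⟩
  have h := hc _ ⟨hD.preimage_comp (fun i : Fin (j + 1) =>
    Fin.lastCases (motive := fun _ => Fin j ⊕ Fin 1) (Sum.inr 0) Sum.inl i), by
      filter_upwards [hev] with s hs
      rw [Set.mem_preimage]
      convert hs using 1
      funext i
      refine Fin.lastCases ?_ (fun i => ?_) i <;> simp⟩
  rw [Set.mem_preimage] at h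
  convert h using 1
  funext i
  refine Fin.lastCases ?_ (fun i => ?_) i <;> simp

/-- In a saturated structure, the limit type of a filter on sequences is realized. -/
lemma IsSaturated.exists_seq_of_filter {κ : Cardinal.{w}} (hκ : Cardinal.aleph0 < κ)
    (hM : IsSaturated L M κ) {A : Set M} (hA : Cardinal.mk A < κ) (F : Filter (ℕ → M)) [F.NeBot] :
    ∃ v : ℕ → M, ∀ D : Set (ℕ → M), A.Definable L D → (∀ᶠ s in F, s ∈ D) → v ∈ D := by
  classical
  -- Saturation realizes types of finite tuples only, so the sequence is built entry by entry, each
  -- initial segment satisfying the limit type.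
  let P : ℕ → Type w := fun j => {d : Fin j → M // ∀ D : Set (Fin j → M), A.Definable L D →
      (∀ᶠ s in F, (fun i : Fin j => s i) ∈ D) → d ∈ D}
  let f : ∀ j, P j := fun j => Nat.rec
    ⟨Fin.elim0, fun D _ h => by
      obtain ⟨s, hs⟩ := h.exists
      convert hs⟩
    (fun j d => ⟨Fin.snoc d.1 (hM.exists_snoc hκ hA F d.1 d.2).choose,
      (hM.exists_snoc hκ hA F d.1 d.2).choose_spec⟩) j
  have hf : ∀ j, (f (j + 1)).1 = Fin.snoc (α := fun _ => M) (f j).1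
    (hM.exists_snoc hκ hA F (f j).1 (f j).2).choose := fun j => rfl
  let v : ℕ → M := fun j => (f (j + 1)).1 (Fin.last j)
  have hv : ∀ j (i : Fin j), (f j).1 i = v i := by
    intro j
    induction j with
    | zero => exact fun i => i.elim0
    | succ j ih =>
      intro i
      refine Fin.lastCases rfl (fun i => ?_) i
      rw [hf, Fin.snoc_castSucc, ih]
      rfl
  refine ⟨v, fun D hD hev => ?_⟩
  obtain ⟨G, D', hD', hG⟩ := exists_finset_of_definable hD
  have hlt : ∀ x : G, (x : ℕ) < G.sup id + 1 := fun x =>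
    Nat.lt_succ_of_le (Finset.le_sup (f := id) x.2)
  have := (f (G.sup id + 1)).2 _ (hD'.preimage_comp
    fun x : G => (⟨x, hlt x⟩ : Fin (G.sup id + 1)))
    (hev.mono fun s hs => (hG s).1 hs)
  rw [hG]
  rw [Set.mem_preimage] at this
  convert this using 1
  funext x
  exact (hv _ ⟨x, hlt x⟩).symm

/-- In a saturated structure, the limit type of a filter on countable tuples is realized. -/
theorem IsSaturated.exists_of_filter {κ : Cardinal.{w}} (hκ : Cardinal.aleph0 < κ)
    (hM : IsSaturated L M κ) {A : Set M} (hA : Cardinal.mk A < κ) {X : Type*} [Countable X]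
    (F : Filter (X → M)) [F.NeBot] :
    ∃ v : X → M, ∀ D : Set (X → M), A.Definable L D → (∀ᶠ s in F, s ∈ D) → v ∈ D := by
  cases isEmpty_or_nonempty X
  · refine ⟨isEmptyElim, fun D _ h => ?_⟩
    obtain ⟨s, hs⟩ := h.exists
    convert hs
  · obtain ⟨g, hg⟩ := exists_surjective_nat X
    obtain ⟨v, hv⟩ := hM.exists_seq_of_filter hκ hA (F.map fun s => s ∘ g)
    refine ⟨v ∘ Function.surjInv hg, fun D hD hev => hv _ (hD.preimage_comp _) ?_⟩
    rw [Filter.eventually_map]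
    filter_upwards [hev] with s hs
    rw [Set.mem_preimage, Function.comp_assoc, (Function.rightInverse_surjInv hg).comp_eq_id]
    exact hs

end Saturation

/-! ### Order patterns of finite configurations -/

section Patterns

/-- Two maps from a finite type into linear orders that induce the same strict preorder factor
through increasing enumerations of their ranges. -/
lemma exists_orderEmbedding_factor {F J J' : Type*} [Finite F] [LinearOrder J] [LinearOrder J']
    (σ : F → J) (τ : F → J') (h : ∀ x y, σ x < σ y ↔ τ x < τ y) :
    ∃ (r : ℕ) (g : F → Fin r) (s : Fin r ↪o J) (t : Fin r ↪o J'),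
      (∀ x, σ x = s (g x)) ∧ ∀ x, τ x = t (g x) := by
  classical
  have := Fintype.ofFinite F
  let S : Finset J := Finset.univ.image σ
  let e := S.orderIsoOfFin rfl
  have hS : ∀ x, σ x ∈ S := fun x => Finset.mem_image_of_mem σ (Finset.mem_univ x)
  have hx : ∀ y, ∃ x, σ x = e y := fun y => by
    obtain ⟨x, -, hx⟩ := Finset.mem_image.1 (e y).2
    exact ⟨x, hx⟩
  choose X hX using hx
  refine ⟨S.card, fun x => e.symm ⟨σ x, hS x⟩, S.orderEmbOfFin rfl,
    OrderEmbedding.ofStrictMono (fun y => τ (X y)) fun y y' hy => ?_, fun x => ?_, fun x => ?_⟩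
  · rw [← h, hX, hX]
    exact e.strictMono hy
  · change σ x = (e (e.symm ⟨σ x, hS x⟩) : J)
    rw [e.apply_symm_apply]
  · change τ x = τ (X _)
    -- Equal values of `σ` force equal values of `τ`, since a strict inequality would be reflected
    -- by `h`.
    have hσ : σ (X (e.symm ⟨σ x, hS x⟩)) = σ x := by rw [hX, e.apply_symm_apply]
    rcases lt_trichotomy (τ x) (τ (X (e.symm ⟨σ x, hS x⟩))) with h1 | h1 | h1
    · exact absurd ((h _ _).2 h1) (by rw [hσ]; exact lt_irrefl _)
    · exact h1
    · exact absurd ((h _ _).2 h1) (by rw [hσ]; exact lt_irrefl _)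

/-- A finite set of points of a linear order can be mapped increasingly to any infinite one. -/
lemma exists_strictMonoOn {Q J : Type*} [LinearOrder Q] [LinearOrder J] [Infinite J]
    (G : Finset Q) : ∃ ρ : Q → J, StrictMonoOn ρ (G : Set Q) := by
  classical
  obtain ⟨T, hT⟩ := Infinite.exists_subset_card_eq J G.card
  obtain ⟨z⟩ : Nonempty J := inferInstance
  let e := (G.orderIsoOfFin rfl).symm.trans (T.orderIsoOfFin hT)
  refine ⟨fun q => if h : q ∈ G then (e ⟨q, h⟩ : J) else z, fun q hq q' hq' hlt => ?_⟩
  have h1 : q ∈ G := hq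
  have h2 : q' ∈ G := hq'
  simp only [h1, h2, dif_pos]
  exact e.strictMono (show (⟨q, h1⟩ : G) < ⟨q', h2⟩ from hlt)

end Patterns

/-! ### Joint indiscernibility and reindexing -/

section Families

variable (L : FirstOrder.Language.{u, v}) {M : Type w} [L.Structure M]

/-- The tuple formed by the members of the sequences `a i` at the places `σ i x`. -/
def familyTuple {ι : Type*} {J : ι → Type*} {m : ι → ℕ} (a : ∀ i, J i → Fin (m i) → M)
    {F : ι → Type*} (σ : ∀ i, F i → J i) : (Σ i, F i × Fin (m i)) → M :=
  fun x => a x.1 (σ x.1 x.2.1) x.2.2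

/-- The families of sequences `a` and `b` have the same joint Ehrenfeucht–Mostowski type over `A`:
subfamilies with the same order relations inside each sequence have the same type over `A`. -/
def SameEM (A : Set M) {ι : Type*} {J J' : ι → Type*} [∀ i, LinearOrder (J i)]
    [∀ i, LinearOrder (J' i)] {m : ι → ℕ} (a : ∀ i, J i → Fin (m i) → M)
    (b : ∀ i, J' i → Fin (m i) → M) : Prop :=
  ∀ (F : ι → Type) (σ : ∀ i, F i → J i) (τ : ∀ i, F i → J' i),
    (∀ i x y, σ i x < σ i y ↔ τ i x < τ i y) →
      SameType L A (familyTuple a σ) (familyTuple b τ)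

variable {L}

/-- It suffices to compare finite subfamilies. -/
lemma SameEM.of_finite {A : Set M} {ι : Type*} {J J' : ι → Type*} [∀ i, LinearOrder (J i)]
    [∀ i, LinearOrder (J' i)] {m : ι → ℕ} {a : ∀ i, J i → Fin (m i) → M}
    {b : ∀ i, J' i → Fin (m i) → M}
    (h : ∀ (F : ι → Type) [∀ i, Finite (F i)] (σ : ∀ i, F i → J i) (τ : ∀ i, F i → J' i),
      (∀ i x y, σ i x < σ i y ↔ τ i x < τ i y) →
        SameType L A (familyTuple a σ) (familyTuple b τ)) : SameEM L A a b := by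
  intro F σ τ hστ D hD
  obtain ⟨G, D', hD', hG⟩ := exists_finset_of_definable hD
  -- Only the places that occur among the finitely many relevant coordinates are kept.
  let F' : ι → Type := fun i => {x : F i // ∃ l : Fin (m i), (⟨i, x, l⟩ : Σ i, F i × Fin (m i)) ∈ G}
  have hF' : ∀ i, Finite (F' i) := fun i =>
    Finite.of_injective (β := G) (fun x => ⟨⟨i, x.1, x.2.choose⟩, x.2.choose_spec⟩)
      fun x y hxy => by
        have h1 := eq_of_heq (Sigma.mk.inj (Subtype.mk.inj hxy)).2
        exact Subtype.ext (Prod.mk.inj h1).1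
  have key := h F' (fun i x => σ i x.1) (fun i x => τ i x.1) (fun i x y => hστ i x.1 y.1) _
    (hD'.preimage_comp fun g : G =>
      (⟨g.1.1, ⟨g.1.2.1, ⟨g.1.2.2, g.2⟩⟩, g.1.2.2⟩ : Σ i, F' i × Fin (m i)))
  rw [hG, hG]
  exact key

/-- An indiscernible sequence is indiscernible for arbitrary finite subfamilies. -/
lemma Indiscernible.sameType {B : Set M} {J : Type w} [LinearOrder J] {m : ℕ} {a : J → Fin m → M}
    (h : Indiscernible L B a) {F : Type*} [Finite F] (σ τ : F → J)
    (hστ : ∀ x y, σ x < σ y ↔ τ x < τ y) :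
    SameType L B (fun x : F × Fin m => a (σ x.1) x.2) (fun x => a (τ x.1) x.2) := by
  obtain ⟨r, g, s, t, hσ, hτ⟩ := exists_orderEmbedding_factor σ τ hστ
  rintro D ⟨ψ, rfl⟩
  have := h r s t (ψ.relabel (Prod.map g id))
  simp only [Formula.realize_relabel] at this
  simp only [Set.mem_ofPred_eq, hσ, hτ]
  exact this

/-- A finite family of mutually indiscernible sequences is jointly indiscernible. -/
theorem MutuallyIndiscernible.sameEM {A : Set M} {ι : Type w} [Finite ι] {J : ι → Type w}
    [∀ i, LinearOrder (J i)] {m : ι → ℕ} {a : ∀ i, J i → Fin (m i) → M}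
    (h : MutuallyIndiscernible L A a) : SameEM L A a a := by
  classical
  have := Fintype.ofFinite ι
  refine SameEM.of_finite fun F hF => ?_
  -- One sequence is moved at a time, the entries of the others serving as parameters; `T` contains
  -- the indices where `σ` and `τ` may differ.
  have key : ∀ (T : Finset ι) (σ τ : ∀ i, F i → J i),
      (∀ i x y, σ i x < σ i y ↔ τ i x < τ i y) → (∀ i ∉ T, σ i = τ i) →
        SameType L A (familyTuple a σ) (familyTuple a τ) := by
    intro T
    induction T using Finset.induction_on with
    | empty =>
      intro σ τ _ hT
      rw [show σ = τ from funext fun i => hT i (Finset.notMem_empty i)]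
      exact fun D _ => Iff.rfl
    | insert i₀ T _ ih =>
      intro σ τ hστ hT D hD
      have hmid := ih (Function.update σ i₀ (τ i₀)) τ (fun i x y => by
          rcases eq_or_ne i i₀ with rfl | hi
          · simp
          · simp [hi, hστ]) (fun i hi => by
          rcases eq_or_ne i i₀ with rfl | hi'
          · simp
          · simp [hi', hT i (by simp [hi, hi'])]) D hD
      rw [← hmid]
      let Y := Σ i : {i // i ≠ i₀}, F i.1 × Fin (m i.1)
      let f : Y → M := fun y => a y.1.1 (σ y.1.1 y.2.1) y.2.2
      let g : (Σ i, F i × Fin (m i)) → Y ⊕ (F i₀ × Fin (m i₀)) := fun x =>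
        if hx : x.1 = i₀ then Sum.inr (hx ▸ x.2) else Sum.inl ⟨⟨x.1, hx⟩, x.2⟩
      have hdef := definable_subst (A := A)
        (B := A ∪ {x | ∃ i', i' ≠ i₀ ∧ ∃ j l, a i' j l = x}) f
        (fun y => Or.inr ⟨y.1.1, y.1.2, _, _, rfl⟩) Set.subset_union_left g hD
      have := (h i₀).sameType (σ i₀) (τ i₀) (hστ i₀) _ hdef
      simp only [Set.mem_ofPred_eq] at this
      convert this using 2
      · funext ⟨i, x, l⟩
        by_cases hi : i = i₀
        · subst hi
          simp [g, familyTuple]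
        · simp [g, hi, f, familyTuple]
      · funext ⟨i, x, l⟩
        by_cases hi : i = i₀
        · subst hi
          simp [g, familyTuple]
        · simp [g, hi, f, familyTuple]
  exact fun σ τ hστ => key Finset.univ σ τ hστ fun i hi => absurd (Finset.mem_univ i) hi

/-- In a saturated structure, jointly indiscernible infinite sequences can be replaced by sequences
indexed by any given countable linear order. -/
theorem SameEM.exists_of_countable {κ : Cardinal.{w}} (hκ : Cardinal.aleph0 < κ)
    (hM : IsSaturated L M κ) {A : Set M} (hA : Cardinal.mk A < κ) {ι : Type*} [Finite ι]
    {J : ι → Type*} [∀ i, LinearOrder (J i)] [∀ i, Infinite (J i)] {m : ι → ℕ}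
    {a : ∀ i, J i → Fin (m i) → M} (h : SameEM L A a a) (Q : Type) [LinearOrder Q] [Countable Q] :
    ∃ b : ∀ i, Q → Fin (m i) → M, SameEM L A a b := by
  classical
  have := Fintype.ofFinite ι
  -- `Q` need not embed in `J i`, but each finite part does. The new family realizes the limit type
  -- of `a` along maps that are eventually increasing on every finite set.
  let O : Finset Q → Set (∀ i, Q → J i) := fun G => {ρ | ∀ i, StrictMonoOn (ρ i) (G : Set Q)}
  let U : Filter (∀ i, Q → J i) := ⨅ G, Filter.principal (O G)
  have hU : U.NeBot := by
    refine Filter.iInf_neBot_of_directed' (fun G G' => ⟨G ∪ G', ?_, ?_⟩) fun G => ?_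
    · exact Filter.principal_mono.2 fun ρ hρ i => (hρ i).mono (by simp)
    · exact Filter.principal_mono.2 fun ρ hρ i => (hρ i).mono (by simp)
    · choose ρ hρ using fun i => exists_strictMonoOn (J := J i) G
      exact Filter.principal_neBot_iff.2 ⟨ρ, hρ⟩
  obtain ⟨v, hv⟩ := hM.exists_of_filter hκ hA
    (U.map fun ρ => familyTuple a (F := fun _ => Q) ρ)
  refine ⟨fun i q l => v ⟨i, q, l⟩, SameEM.of_finite fun F hF σ τ hστ => ?_⟩
  have := fun i => Fintype.ofFinite (F i)
  refine SameType.of_imp fun D hD hσ => ?_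
  refine hv _ (hD.preimage_comp fun x : Σ i, F i × Fin (m i) =>
    (⟨x.1, τ x.1 x.2.1, x.2.2⟩ : Σ _, Q × Fin _)) ?_
  rw [Filter.eventually_map]
  let G : Finset Q := Finset.univ.biUnion fun i => Finset.univ.image (τ i)
  have hG : ∀ i x, τ i x ∈ (G : Set Q) := fun i x => by
    simp only [G, Finset.mem_coe, Finset.mem_biUnion, Finset.mem_image, Finset.mem_univ, true_and]
    exact ⟨i, x, rfl⟩
  have hO : ∀ᶠ ρ in U, ρ ∈ O G := Filter.mem_iInf_of_mem G (Filter.mem_principal_self _)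
  filter_upwards [hO] with ρ hρ
  exact (h F σ (fun i x => ρ i (τ i x)) (fun i x y => by
    rw [hστ, (hρ i).lt_iff_lt (hG i x) (hG i y)]) D hD).1 hσ

end Families

instance countable_nat_lex_nat : Countable (ℕ ×ₗ ℕ) := Countable.of_equiv (ℕ × ℕ) toLex

/-! ### From alternations to dp-rank -/

section Alternations

variable {L : FirstOrder.Language.{u, v}} {M : Type w} [L.Structure M]

/-- A family with the Ehrenfeucht–Mostowski type of infinite sequences is jointly indiscernible. -/
lemma SameEM.right {A : Set M} {ι : Type*} {J J' : ι → Type*} [∀ i, LinearOrder (J i)]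
    [∀ i, Infinite (J i)] [∀ i, LinearOrder (J' i)] {m : ι → ℕ} {a : ∀ i, J i → Fin (m i) → M}
    {b : ∀ i, J' i → Fin (m i) → M} (h : SameEM L A a b) : SameEM L A b b := by
  classical
  refine SameEM.of_finite fun F hF σ τ hστ D hD => ?_
  have := fun i => Fintype.ofFinite (F i)
  choose ρ hρ using fun i => exists_strictMonoOn (J := J i) (Finset.univ.image (τ i))
  have hlt : ∀ i x y, ρ i (τ i x) < ρ i (τ i y) ↔ τ i x < τ i y := fun i x y =>
    (hρ i).lt_iff_lt (by simp) (by simp)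
  rw [← h F (fun i x => ρ i (τ i x)) τ hlt D hD]
  exact (h F (fun i x => ρ i (τ i x)) σ (fun i x y => by rw [hlt, hστ]) D hD).symm

/-- In a saturated structure, an infinite indiscernible sequence can be replaced by one indexed by
any given countable linear order. -/
lemma Indiscernible.exists_of_countable {κ : Cardinal.{w}} (hκ : Cardinal.aleph0 < κ)
    (hM : IsSaturated L M κ) {A : Set M} (hA : Cardinal.mk A < κ)
    {J : Type w} [LinearOrder J] [Infinite J] {m : ℕ} {a : J → Fin m → M}
    (h : Indiscernible L A a) (Q : Type) [LinearOrder Q] [Countable Q] :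
    ∃ b : Q → Fin m → M,
      (∀ (F : Type) (σ : F → J) (τ : F → Q), (∀ x y, σ x < σ y ↔ τ x < τ y) →
        SameType L A (fun x : F × Fin m => a (σ x.1) x.2) (fun x => b (τ x.1) x.2)) ∧
      ∀ (F : Type) (σ τ : F → Q), (∀ x y, σ x < σ y ↔ τ x < τ y) →
        SameType L A (fun x : F × Fin m => b (σ x.1) x.2) (fun x => b (τ x.1) x.2) := by
  have hmut : MutuallyIndiscernible L A (ι := PUnit.{w + 1}) (fun _ => a) := fun i => by
    have : A ∪ {x | ∃ i', i' ≠ i ∧ ∃ j l, a j l = x} = A := by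
      refine Set.union_eq_self_of_subset_right ?_
      rintro x ⟨i', hi', -⟩
      exact absurd (Subsingleton.elim i' i) hi'
    rw [this]
    exact h
  obtain ⟨b, hb⟩ := hmut.sameEM.exists_of_countable hκ hM hA Q
  exact ⟨b PUnit.unit,
    fun F σ τ hστ => (hb (fun _ => F) (fun _ => σ) (fun _ => τ) (fun _ => hστ)).comp
      (fun x : F × Fin m => ⟨PUnit.unit, x⟩),
    fun F σ τ hστ => (hb.right (fun _ => F) (fun _ => σ) (fun _ => τ) (fun _ => hστ)).comp
      (fun x : F × Fin m => ⟨PUnit.unit, x⟩)⟩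

lemma SameType.realizes {A : Set M} {n : ℕ} {p : Set (L[[A]].Formula (Fin n))} {c c' : Fin n → M}
    (h : SameType L A c c') (hc : Realizes L p c) : Realizes L p c' :=
  fun ψ hψ => (h _ (definable_setOf_realize ψ)).1 (hc ψ hψ)

/-- Disjoint convex pieces of an indiscernible sequence are mutually indiscernible. -/
lemma indiscernible_piece {A : Set M} {m : ℕ} {b : ℕ ×ₗ ℕ → Fin m → M}
    (hb : ∀ (F : Type) (σ τ : F → ℕ ×ₗ ℕ), (∀ x y, σ x < σ y ↔ τ x < τ y) →
      SameType L A (fun x : F × Fin m => b (σ x.1) x.2) (fun x => b (τ x.1) x.2)) (i : ℕ)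
    {J : Type w} [LinearOrder J] (e : J ↪o ℕ) :
    Indiscernible L (A ∪ {x | ∃ i' ≠ i, ∃ j l, b (toLex (i', j)) l = x})
      (fun j : J => b (toLex (i, e j))) := by
  intro r s t ψ
  let f : {q : ℕ × ℕ // q.1 ≠ i} × Fin m → M := fun y => b (toLex y.1.1) y.2
  obtain ⟨D', hD', hD⟩ := exists_definable_sumElim (A := A) f (by
    refine Set.union_subset_union_right A ?_
    rintro x ⟨i', hi', j, l, rfl⟩
    exact ⟨(⟨(i', j), hi'⟩, l), rfl⟩) (definable_setOf_realize ψ)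
  have key : ∀ s : Fin r ↪o J, Sum.elim f (fun x : Fin r × Fin m => b (toLex (i, e (s x.1))) x.2) =
      (fun x : ({q : ℕ × ℕ // q.1 ≠ i} ⊕ Fin r) × Fin m =>
        b (Sum.elim (fun q => toLex q.1) (fun x => toLex (i, e (s x))) x.1) x.2) ∘
        Sum.elim (fun y => (Sum.inl y.1, y.2)) (fun x => (Sum.inr x.1, x.2)) := fun s => by
    funext x
    rcases x with x | x <;> rfl
  have hs := hD (fun x => b (toLex (i, e (s x.1))) x.2)
  have ht := hD (fun x => b (toLex (i, e (t x.1))) x.2)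
  rw [key] at hs ht
  refine hs.trans (Iff.trans ?_ ht.symm)
  -- A point of another row compares with all points of row `i` in the same way, so moving `s` to
  -- `t` inside the row preserves the order pattern.
  refine (hb _ _ _ fun x y => ?_).comp _ D' hD'
  rcases x with ⟨⟨q, q'⟩, hq⟩ | x <;> rcases y with ⟨⟨z, z'⟩, hz⟩ | y
  · rfl
  · simp only [Sum.elim_inl, Sum.elim_inr, Prod.Lex.toLex_lt_toLex]
    simp only at hq
    simp [hq]
  · simp only [Sum.elim_inl, Sum.elim_inr, Prod.Lex.toLex_lt_toLex]
    simp only at hz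
    simp [hz.symm]
  · simp [Prod.Lex.toLex_lt_toLex]

/-- Indiscernibility over `c` for formulas in one member of the sequence. -/
lemma Indiscernible.realize_iff {A : Set M} {n m : ℕ} {c : Fin n → M} {J : Type w} [LinearOrder J]
    {a : J → Fin m → M} (h : Indiscernible L (A ∪ Set.range c) a) (φ : L.Formula (Fin n ⊕ Fin m))
    (x y : J) : φ.Realize (Sum.elim c (a x)) ↔ φ.Realize (Sum.elim c (a y)) := by
  have hdef : (A ∪ Set.range c).Definable L {v : Fin m → M | φ.Realize (Sum.elim c v)} :=
    definable_sumElim c (definable_setOf_realize_of_formula A φ)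
  exact h.sameType (F := Fin 1) (fun _ => x) (fun _ => y) (fun _ _ => by simp) _
    (hdef.preimage_comp fun l : Fin m => ((0 : Fin 1), l))

/-- If some formula has `p`-alternation rank at least `2 * k`, then the dp-rank of `p` is at least
`k`. -/
theorem AltRankGE.dpRankGE {κ : Cardinal.{w}} (hκ : Cardinal.aleph0 < κ)
    (hM : IsSaturated L M κ) {A : Set M} (hA : Cardinal.mk A < κ) {n m k : ℕ}
    {p : Set (L[[A]].Formula (Fin n))} {φ : L.Formula (Fin n ⊕ Fin m)}
    (h : AltRankGE L p φ (2 * k)) : DpRankGE L p (k : Cardinal.{w}) := by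
  obtain ⟨J, _, _, a, ha, c, hc, j, halt⟩ := h
  obtain ⟨b, hab, hbb⟩ := ha.exists_of_countable hκ hM hA (ℕ ×ₗ ℕ)
  -- The points `2 * i` and `2 * i + 1` open row `i`. The last of the `2 * k + 1` alternating points
  -- is not needed.
  let τ : Fin (2 * k) → ℕ ×ₗ ℕ := fun x => toLex ((x : ℕ) / 2, (x : ℕ) % 2)
  obtain ⟨c', hc'⟩ := hM.exists_sameType hκ hA (hab (Fin (2 * k)) (fun x => j x.castSucc) τ
    (fun x y => by
      simp only [OrderEmbedding.lt_iff_lt, τ, Prod.Lex.toLex_lt_toLex, Fin.lt_def,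
        Fin.val_castSucc]
      omega)) c
  have hp : Realizes L p c' := (hc'.comp Sum.inr).realizes hc
  have hφ : ∀ x : Fin (2 * k), φ.Realize (Sum.elim c (a (j x.castSucc))) ↔
      φ.Realize (Sum.elim c' (b (τ x))) := by
    intro x
    have := (hc'.comp (Sum.elim Sum.inr (fun l => Sum.inl (x, l)) :
      Fin n ⊕ Fin m → (Fin (2 * k) × Fin m) ⊕ Fin n)) _ (definable_setOf_realize_of_formula A φ)
    simp only [Set.mem_ofPred_eq, Sum.comp_elim, Sum.elim_comp_inr] at this
    exact this
  intro ν hν hle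
  obtain ⟨r, rfl⟩ := Cardinal.lt_aleph0.1 (hν.trans (Cardinal.natCast_lt_aleph0))
  have hr : r < k := by exact_mod_cast hν
  obtain ⟨i, hi⟩ := hle c' hp (ULift (Fin (1 + r))) (by simp) (fun _ => ULift ℕ) (fun _ => m)
    (fun i j => b (toLex ((i.down : ℕ), j.down))) (fun i r s t ψ => by
      let e : ULift.{w} ℕ ↪o ℕ := OrderEmbedding.ofStrictMono ULift.down fun _ _ h => h
      have hdef := definable_setOf_realize ψ
      obtain ⟨χ, hχ⟩ := hdef.mono (B := A ∪ {x | ∃ i' ≠ (i.down : ℕ), ∃ j l,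
          b (toLex (i', j)) l = x}) (Set.union_subset_union_right A (by
        rintro x ⟨i', hi', j, l, rfl⟩
        exact ⟨i'.down, fun h => hi' (ULift.ext _ _ (Fin.ext h)), j.down, l, rfl⟩))
      have h1 := fun v => Set.ext_iff.1 hχ v
      simp only [Set.mem_ofPred_eq] at h1
      rw [h1, h1]
      exact indiscernible_piece hbb (i.down : ℕ) e r s t χ)
  have hik : (i.down : ℕ) < k := by omega
  have e1 := hφ ⟨2 * i.down, by omega⟩
  have e2 := hφ ⟨2 * i.down + 1, by omega⟩
  have e3 : τ ⟨2 * i.down, by omega⟩ = toLex ((i.down : ℕ), 0) := by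
    simp only [τ]; congr 2 <;> omega
  have e4 : τ ⟨2 * i.down + 1, by omega⟩ = toLex ((i.down : ℕ), 1) := by
    simp only [τ]; congr 2 <;> omega
  rw [e3] at e1
  rw [e4] at e2
  have h1 : φ.Realize (Sum.elim c (a (j (Fin.castSucc ⟨2 * i.down, by omega⟩)))) ↔
      ¬ φ.Realize (Sum.elim c (a (j (Fin.castSucc ⟨2 * i.down + 1, by omega⟩)))) := by
    rw [halt ⟨2 * i.down, by omega⟩]
    rfl
  rw [e1, e2, hi.realize_iff φ (ULift.up 0) (ULift.up 1)] at h1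
  exact iff_not_self h1

end Alternations

/-! ### From dp-rank to a definable selection -/

section Selection

/-- A property of increasing tuples that is not constant changes at some modification of a single
coordinate. -/
lemma exists_single_change {J : Type*} [LinearOrder J] {r : ℕ} (P : (Fin r ↪o J) → Prop)
    {s t : Fin r ↪o J} (hs : P s) (ht : ¬ P t) :
    ∃ (s' t' : Fin r ↪o J) (l : Fin r), P s' ∧ ¬ P t' ∧ ∀ y, y ≠ l → s' y = t' y := by
  by_contra hne
  push Not at hne
  have hP : ∀ s' t' : Fin r ↪o J, ∀ l : Fin r, (∀ y, y ≠ l → s' y = t' y) → (P s' ↔ P t') := by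
    intro s' t' l h
    constructor
    · intro h1
      by_contra h2
      obtain ⟨y, hy, hy'⟩ := hne s' t' l h1 h2
      exact hy' (h y hy)
    · intro h1
      by_contra h2
      obtain ⟨y, hy, hy'⟩ := hne t' s' l h1 h2
      exact hy' (h y hy).symm
  -- Passing directly from `s` to `t` coordinate by coordinate may leave the increasing tuples.
  -- Passing from each of them to the pointwise maximum does not, and the maximum is symmetric.
  let W : (Fin r ↪o J) → (Fin r ↪o J) → ℕ → (Fin r ↪o J) := fun s t h =>
    OrderEmbedding.ofStrictMono (fun y => if (y : ℕ) < h then s y else max (s y) (t y))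
      fun y y' hy => by
        have hlt : (y : ℕ) < y' := hy
        have h1 := s.strictMono hy
        have h2 := t.strictMono hy
        simp only
        split_ifs with h3 h4
        · exact h1
        · exact lt_max_of_lt_left h1
        · omega
        · exact max_lt_max h1 h2
  have hW : ∀ s t h, h ≤ r → (P (W s t h) ↔ P (W s t 0)) := by
    intro s t h
    induction h with
    | zero => exact fun _ => Iff.rfl
    | succ h ih =>
      intro hr
      rw [← ih (by omega)]
      refine hP _ _ ⟨h, hr⟩ fun y hy => ?_
      have hy' : (y : ℕ) ≠ h := fun h' => hy (Fin.ext h')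
      change (if (y : ℕ) < h + 1 then s y else max (s y) (t y)) =
        if (y : ℕ) < h then s y else max (s y) (t y)
      split_ifs <;> first | rfl | omega
  have hWr : ∀ s t, W s t r = s := fun s t => by
    ext y
    simp [W]
  have hW0 : W s t 0 = W t s 0 := by
    ext y
    simp [W, max_comm]
  have h1 := hW s t r le_rfl
  have h2 := hW t s r le_rfl
  rw [hWr] at h1 h2
  exact ht (h2.2 (hW0 ▸ h1.1 hs))

/-- If a property of natural numbers holds at `3 * e` and fails at `3 * e + 1`, one can choose an
increasing pair in each interval `[3 * j, 3 * j + 3)` in such a way that the pair in the `e`-th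
interval is the only one at which the property is lost. -/
lemma exists_pairs (f : ℕ → Prop) {e : ℕ} (h : f (3 * e)) (h' : ¬ f (3 * e + 1)) :
    ∃ g : ℕ → Fin 2 → ℕ, ∀ j, 3 * j ≤ g j 0 ∧ g j 0 < g j 1 ∧ g j 1 < 3 * j + 3 ∧
      ((f (g j 0) ∧ ¬ f (g j 1)) ↔ j = e) := by
  have key : ∀ j, ∃ x y : ℕ, 3 * j ≤ x ∧ x < y ∧ y < 3 * j + 3 ∧ ((f x ∧ ¬ f y) ↔ j = e) := by
    intro j
    -- Off `e`, the middle point decides: if `f` holds there it serves as second point, otherwise as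
    -- first, and either way nothing is lost. This is why the intervals have length three.
    by_cases hj : j = e
    · subst hj
      exact ⟨3 * j, 3 * j + 1, by omega, by omega, by omega, by simp [h, h']⟩
    · by_cases h1 : f (3 * j + 1)
      · exact ⟨3 * j, 3 * j + 1, by omega, by omega, by omega, by simp [h1, hj]⟩
      · exact ⟨3 * j + 1, 3 * j + 2, by omega, by omega, by omega, by simp [h1, hj]⟩
  choose x y hxy using key
  exact ⟨fun j => ![x j, y j], fun j => by simpa using hxy j⟩

/-- The places `(y, 0)`, for `y ≠ l`, together with the place `(l, j)`. -/
def place {r : ℕ} (l : Fin r) (j : ℕ) (y : Fin r) : ℕ ×ₗ ℕ :=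
  toLex ((y : ℕ), if y = l then j else 0)

/-- The second coordinates matter only through `j < j'`, so increasing reindexings of `j` preserve
the pattern. The form agrees with that of `pair_lt_pair`, which lets `s` and `t` be matched with two
such places. -/
lemma place_lt_place {r : ℕ} (l : Fin r) (j j' : ℕ) (y y' : Fin r) :
    place l j y < place l j' y' ↔ y < y' ∨ y = y' ∧ y = l ∧ j < j' := by
  simp only [place, Prod.Lex.toLex_lt_toLex, Fin.lt_def, ← Fin.ext_iff]
  by_cases h : y = y'
  · subst h
    by_cases h' : y = l <;> simp [h']
  · simp [h]

variable {L : FirstOrder.Language.{u, v}} {M : Type w} [L.Structure M]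

/-- Non-indiscernibility over `A` and `c` is witnessed by an `A`-definable condition on `c` and a
tuple from the sequence that changes with a single entry of the tuple. -/
lemma exists_witness_of_not_indiscernible {A : Set M} {n m : ℕ} (c : Fin n → M) {J : Type w}
    [LinearOrder J] {a : J → Fin m → M} (h : ¬ Indiscernible L (A ∪ Set.range c) a) :
    ∃ (r : ℕ) (s t : Fin r ↪o J) (l : Fin r) (E : Set (Fin n ⊕ (Fin r × Fin m) → M)),
      A.Definable L E ∧ Sum.elim c (fun x => a (s x.1) x.2) ∈ E ∧
        Sum.elim c (fun x => a (t x.1) x.2) ∉ E ∧ (∀ y, y ≠ l → s y = t y) ∧ s l < t l := by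
  simp only [Indiscernible, not_forall] at h
  obtain ⟨r, s, t, ψ, hψ⟩ := h
  obtain ⟨E, hE, hE'⟩ := exists_definable_sumElim c subset_rfl (definable_setOf_realize ψ)
  have hP : ∃ s t : Fin r ↪o J, ψ.Realize (fun x => a (s x.1) x.2) ∧
      ¬ ψ.Realize (fun x => a (t x.1) x.2) := by
    by_cases hs : ψ.Realize (fun x => a (s x.1) x.2)
    · exact ⟨s, t, hs, fun ht => hψ (iff_of_true hs ht)⟩
    · exact ⟨t, s, by_contra fun ht => hψ (iff_of_false hs ht), hs⟩
  obtain ⟨s, t, hs, ht⟩ := hP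
  obtain ⟨s, t, l, hs, ht, hst⟩ :=
    exists_single_change (fun s => ψ.Realize (fun x => a (s x.1) x.2)) hs ht
  have hs' := (hE' _).1 hs
  have ht' := fun h => ht ((hE' _).2 h)
  rcases lt_trichotomy (s l) (t l) with hl | hl | hl
  · exact ⟨r, s, t, l, E, hE, hs', ht', hst, hl⟩
  · have : s = t := by
      ext y
      by_cases hy : y = l
      · rw [hy, hl]
      · exact hst y hy
    exact absurd (this ▸ hs) ht
  -- If the entry moves to the left, the roles of the tuples are exchanged and the condition is
  -- negated.
  · exact ⟨r, t, s, l, Eᶜ, hE.compl, ht', fun h => h hs', fun y hy => (hst y hy).symm, hl⟩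

/-- The order relations among the entries of two increasing tuples differing in one entry. -/
lemma pair_lt_pair {J : Type*} [LinearOrder J] {r : ℕ} {s t : Fin r ↪o J} {l : Fin r}
    (hst : ∀ y, y ≠ l → s y = t y) (hl : s l < t l) (e e' : Fin 2) (y y' : Fin r) :
    (![s, t] e y < ![s, t] e' y') ↔ y < y' ∨ y = y' ∧ y = l ∧ e < e' := by
  have hle : ∀ y, s y ≤ t y := fun y => by
    by_cases hy : y = l
    · rw [hy]; exact hl.le
    · exact (hst y hy).le
  have hlt : ∀ y y', y < y' → t y < s y' := fun y y' h => by
    by_cases hy : y = l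
    · rw [hst y' (by rintro rfl; exact h.ne hy)]
      exact t.strictMono h
    · rw [← hst y hy]
      exact s.strictMono h
  have hlo : ∀ e y, s y ≤ ![s, t] e y := fun e y => by
    fin_cases e
    · exact le_rfl
    · exact hle y
  have hhi : ∀ e y, ![s, t] e y ≤ t y := fun e y => by
    fin_cases e
    · exact hle y
    · exact le_rfl
  rcases lt_trichotomy y y' with h | rfl | h
  · exact iff_of_true (((hhi e y).trans_lt (hlt y y' h)).trans_le (hlo e' y')) (Or.inl h)
  · by_cases hy : y = l
    · subst hy
      fin_cases e <;> fin_cases e' <;> simp [hl, hl.le]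
    · have : ∀ e, ![s, t] e y = s y := fun e => by
        fin_cases e
        · rfl
        · exact (hst y hy).symm
      simp [this, hy]
  · refine iff_of_false (not_lt_of_gt
      (((hhi e' y').trans_lt (hlt y' y h)).trans_le (hlo e y))) ?_
    rintro (h' | ⟨h', -⟩)
    · exact lt_asymm h h'
    · exact h.ne h'.symm

lemma SameType.mem_iff {A : Set M} {X W : Type*} {n : ℕ} {v w : X → M} {c c' : Fin n → M}
    (h : SameType L A (Sum.elim v c) (Sum.elim w c')) (f : W → X) {D : Set (Fin n ⊕ W → M)}
    (hD : A.Definable L D) : Sum.elim c (v ∘ f) ∈ D ↔ Sum.elim c' (w ∘ f) ∈ D := by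
  have := (h.comp (Sum.elim Sum.inr (fun x => Sum.inl (f x)))) D hD
  simp only [Sum.comp_elim, Sum.elim_comp_inr] at this
  exact this

/-- From `k` mutually indiscernible sequences, none of which is indiscernible over a realization of
`p`, one obtains an indiscernible sequence all of whose `k`-element subsets are cut out by one
definable condition on realizations of `p`. -/
theorem exists_definable_selection {κ : Cardinal.{w}} (hκ : Cardinal.aleph0 < κ)
    (hM : IsSaturated L M κ) {A : Set M} (hA : Cardinal.mk A < κ) {n k : ℕ}
    {p : Set (L[[A]].Formula (Fin n))} {c : Fin n → M} (hc : Realizes L p c)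
    {ι : Type w} [Finite ι] (hk : Nat.card ι = k) {J : ι → Type w} [∀ i, LinearOrder (J i)]
    [∀ i, Infinite (J i)] {m : ι → ℕ} {a : ∀ i, J i → Fin (m i) → M}
    (ha : MutuallyIndiscernible L A a) (hna : ∀ i, ¬ Indiscernible L (A ∪ Set.range c) (a i)) :
    ∃ (W : Type w) (_ : Finite W) (a' : ℕ → W → M) (E : Set (Fin n ⊕ W → M)),
      A.Definable L E ∧
      (∀ (F : Type) (σ τ : F → ℕ), (∀ x y, σ x < σ y ↔ τ x < τ y) →
        SameType L A (fun x : F × W => a' (σ x.1) x.2) (fun x => a' (τ x.1) x.2)) ∧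
      ∀ S : Finset ℕ, S.card = k → ∃ c : Fin n → M, Realizes L p c ∧
        ∀ j, Sum.elim c (a' j) ∈ E ↔ j ∈ S := by
  choose r s t l E hE hs ht hst hl using fun i => exists_witness_of_not_indiscernible c (hna i)
  obtain ⟨b, hab⟩ := ha.sameEM.exists_of_countable hκ hM hA (ℕ ×ₗ ℕ)
  have hbb := hab.right
  let row : ∀ i, ℕ → Fin (r i) × Fin (m i) → M := fun i j x => b i (place (l i) j x.1) x.2
  -- The `j`-th term joins, for all `i`, the tuples number `2 * j` and `2 * j + 1` of `row i`; the
  -- condition says that for some `i` the first satisfies `E i` and the second does not.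
  refine ⟨Fin 2 × Σ i, Fin (r i) × Fin (m i), inferInstance,
    fun j x => row x.2.1 (2 * j + x.1) x.2.2,
    ⋃ i, ((fun v => v ∘ Sum.map id fun x => ((0 : Fin 2), ⟨i, x⟩)) ⁻¹' E i) \
      ((fun v => v ∘ Sum.map id fun x => ((1 : Fin 2), ⟨i, x⟩)) ⁻¹' E i),
    Set.definable_iUnion_of_finite fun i => ((hE i).preimage_comp _).sdiff ((hE i).preimage_comp _),
    fun F σ τ hστ => ?_, fun S hS => ?_⟩
  · exact (hbb (fun i => F × Fin 2 × Fin (r i))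
      (fun i x => place (l i) (2 * σ x.1 + x.2.1) x.2.2)
      (fun i x => place (l i) (2 * τ x.1 + x.2.1) x.2.2) (fun i x y => by
        rw [place_lt_place, place_lt_place]
        have h1 := hστ x.1 y.1
        have h2 := hστ y.1 x.1
        have h3 := x.2.1.isLt
        have h4 := y.2.1.isLt
        have : 2 * σ x.1 + x.2.1 < 2 * σ y.1 + y.2.1 ↔ 2 * τ x.1 + x.2.1 < 2 * τ y.1 + y.2.1 := by
          omega
        rw [this])).comp
      (fun x : F × Fin 2 × Σ i, Fin (r i) × Fin (m i) =>
        ⟨x.2.2.1, (x.1, x.2.1, x.2.2.2.1), x.2.2.2.2⟩)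
  · let η : ι ≃ S := (Finite.equivFinOfCardEq hk).trans (S.equivFinOfCardEq hS).symm
    -- Over `c₁` the loss of `E i` occurs between `3 * η i` and `3 * η i + 1`, the position required
    -- by `exists_pairs`.
    obtain ⟨c₁, hc₁⟩ := hM.exists_sameType hκ hA (hab (fun i => Fin 2 × Fin (r i))
      (fun i x => ![s i, t i] x.1 x.2) (fun i x => place (l i) (3 * η i + x.1) x.2)
      (fun i x y => by
        have : 3 * (η i : ℕ) + x.1 < 3 * η i + y.1 ↔ x.1 < y.1 := by
          rw [Fin.lt_def]
          omega
        rw [pair_lt_pair (hst i) (hl i), place_lt_place, this])) c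
    have h0 : ∀ i, Sum.elim c₁ (row i (3 * η i)) ∈ E i := fun i =>
      (hc₁.mem_iff (fun x : Fin (r i) × Fin (m i) => ⟨i, (0, x.1), x.2⟩) (hE i)).1 (hs i)
    have h1 : ∀ i, Sum.elim c₁ (row i (3 * η i + 1)) ∉ E i := fun i h =>
      ht i <| (hc₁.mem_iff (fun x : Fin (r i) × Fin (m i) => ⟨i, (1, x.1), x.2⟩) (hE i)).2 h
    choose g hg using fun i => exists_pairs (fun j => Sum.elim c₁ (row i j) ∈ E i) (h0 i) (h1 i)
    -- The chosen pairs depend on `c₁` and `S`. Moving them to the fixed positions `2 * j`, `2 * j +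
    -- 1` makes the sequence and the condition independent of `S`; only `c₂` varies.
    obtain ⟨c₂, hc₂⟩ := hM.exists_sameType hκ hA (hbb (fun i => ℕ × Fin 2 × Fin (r i))
      (fun i x => place (l i) (g i x.1 x.2.1) x.2.2)
      (fun i x => place (l i) (2 * x.1 + x.2.1) x.2.2) (fun i ⟨j, e, y⟩ ⟨j', e', y'⟩ => by
        rw [place_lt_place, place_lt_place]
        have h2 := hg i j
        have h3 := hg i j'
        have : g i j e < g i j' e' ↔ 2 * j + (e : ℕ) < 2 * j' + e' := by
          rcases lt_trichotomy j j' with h | rfl | h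
          · fin_cases e <;> fin_cases e' <;> simp <;> omega
          · fin_cases e <;> fin_cases e' <;> simp <;> omega
          · fin_cases e <;> fin_cases e' <;> simp <;> omega
        rw [this])) c₁
    refine ⟨c₂, (hc₂.comp Sum.inr).realizes ((hc₁.comp Sum.inr).realizes hc), fun j => ?_⟩
    have hrow : ∀ i e, Sum.elim c₁ (row i (g i j e)) ∈ E i ↔
        Sum.elim c₂ (row i (2 * j + (e : Fin 2))) ∈ E i := fun i e =>
      hc₂.mem_iff (fun x : Fin (r i) × Fin (m i) => ⟨i, (j, e, x.1), x.2⟩) (hE i)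
    simp only [Set.mem_iUnion, Set.mem_sdiff, Set.mem_preimage, Sum.elim_comp_map,
      Function.comp_id]
    have hi : ∀ i, (Sum.elim c₂ (row i (2 * j + (0 : Fin 2))) ∈ E i ∧
        Sum.elim c₂ (row i (2 * j + (1 : Fin 2))) ∉ E i) ↔ j = η i := fun i => by
      rw [← hrow, ← hrow]
      exact (hg i j).2.2.2
    refine (exists_congr hi).trans ⟨?_, fun h => ⟨η.symm ⟨j, h⟩, by simp⟩⟩
    rintro ⟨i, rfl⟩
    exact (η i).2

end Selection

/-! ### The implications (i) to (ii) and (ii) to (iii) -/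

section Main

variable {L : FirstOrder.Language.{u, v}} {M : Type w} [L.Structure M]

/-- If `p` has dp-rank at least `k`, then there are a formula and an indiscernible sequence all of
whose `k`-element subsets are cut out by the formula for realizations of `p`. -/
theorem DpRankGE.exists_selection {κ : Cardinal.{w}} (hκ : Cardinal.aleph0 < κ)
    (hM : IsSaturated L M κ) {A : Set M} (hA : Cardinal.mk A < κ) {n k : ℕ}
    {p : Set (L[[A]].Formula (Fin n))} (hp : IsPartialType L p)
    (h : DpRankGE L p (k : Cardinal.{w})) :
    ∃ (m : ℕ) (φ : L.Formula (Fin n ⊕ Fin m))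
      (J : Type w) (_ : LinearOrder J) (_ : Infinite J) (a : J → Fin m → M),
      Indiscernible L A a ∧ ∀ S : Finset J, S.card = k →
        ∃ c : Fin n → M, Realizes L p c ∧ ∀ j : J, φ.Realize (Sum.elim c (a j)) ↔ j ∈ S := by
  have hsel : ∃ (W : Type w) (_ : Finite W) (a' : ℕ → W → M) (E : Set (Fin n ⊕ W → M)),
      A.Definable L E ∧
      (∀ (F : Type) (σ τ : F → ℕ), (∀ x y, σ x < σ y ↔ τ x < τ y) →
        SameType L A (fun x : F × W => a' (σ x.1) x.2) (fun x => a' (τ x.1) x.2)) ∧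
      ∀ S : Finset ℕ, S.card = k → ∃ c : Fin n → M, Realizes L p c ∧
        ∀ j, Sum.elim c (a' j) ∈ E ↔ j ∈ S := by
    cases k with
    | zero =>
      -- Dp-rank at least `0` says nothing, so a realization has to come from the consistency of
      -- `p`; the family of sequences is empty.
      obtain ⟨c, hc⟩ := hM A hA n p hp
      exact exists_definable_selection hκ hM hA hc (ι := PEmpty.{w + 1}) (by simp)
        (J := fun _ => ULift ℕ) (m := fun _ => 0) (a := fun i => i.elim) (fun i => i.elim)
        fun i => i.elim
    | succ k =>
      have hk := h k (by exact_mod_cast k.lt_succ_self)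
      simp only [DpRankLE, not_forall] at hk
      obtain ⟨c, hc, ι, hι, J, _, _, m, a, ha, hna⟩ := hk
      have hι' : Cardinal.mk ι = ((k + 1 : ℕ) : Cardinal.{w}) := by
        rw [hι, Nat.cast_succ, add_comm]
      have : Finite ι := Cardinal.lt_aleph0_iff_finite.1 (hι' ▸ Cardinal.natCast_lt_aleph0)
      exact exists_definable_selection hκ hM hA hc
        (by rw [Nat.card, hι', Cardinal.toNat_natCast]) ha (not_exists.1 hna)
  obtain ⟨W, _, a', E, hE, ha', hS⟩ := hsel
  obtain ⟨N, e, φ, he, hφ⟩ := exists_formula_of_definable hE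
  have := Fintype.ofFinite W
  let q : Fin N ⊕ W ≃ Fin (Fintype.card (Fin N ⊕ W)) := Fintype.equivFin _
  -- The formula must be free of parameters, so the parameters `e` are appended to every term of the
  -- sequence. They lie in `A`, hence indiscernibility over `A` survives.
  refine ⟨_, φ.relabel (Sum.elim (fun x => Sum.inr (q (Sum.inl x)))
    (Sum.elim Sum.inl (fun x => Sum.inr (q (Sum.inr x))))), ULift ℕ, inferInstance, inferInstance,
    fun j l => Sum.elim e (a' j.down) (q.symm l), fun r s t ψ => ?_, fun S hcard => ?_⟩
  · have hdef := definable_subst e he subset_rfl (fun x : Fin r × Fin (Fintype.card (Fin N ⊕ W)) =>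
      Sum.map id (fun y : W => (x.1, y)) (q.symm x.2)) (definable_setOf_realize ψ)
    have hmem : ∀ s : Fin r ↪o ULift.{w} ℕ,
        (ψ.Realize (fun x => Sum.elim e (a' (s x.1).down) (q.symm x.2)) ↔
          (fun x : Fin r × W => a' (s x.1).down x.2) ∈ {v : Fin r × W → M | (fun x =>
            Sum.elim e v (Sum.map id (fun y : W => (x.1, y)) (q.symm x.2))) ∈
              {v | ψ.Realize v}}) := fun s => by
      simp only [Set.mem_ofPred_eq]
      apply iff_of_eq
      congr 1
      funext x
      rcases q.symm x.2 with y | y <;> rfl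
    rw [hmem, hmem]
    exact ha' (Fin r) (fun x => (s x).down) (fun x => (t x).down)
      (fun x y => (s.lt_iff_lt (a := x) (b := y)).trans t.lt_iff_lt.symm) _ hdef
  · obtain ⟨c, hc, hcS⟩ := hS (S.map Equiv.ulift.toEmbedding) (by simpa using hcard)
    refine ⟨c, hc, fun j => ?_⟩
    have hj : j ∈ S ↔ j.down ∈ S.map Equiv.ulift.toEmbedding := by
      simp only [Finset.mem_map_equiv]
      rfl
    rw [hj, ← hcS, hφ, Formula.realize_relabel]
    apply iff_of_eq
    congr 1
    funext x
    rcases x with x | x | x <;> simp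

/-- A formula cutting out all `k`-element subsets of an infinite indiscernible sequence has
alternation rank at least `2 * k`. -/
lemma hasAlternations_of_selection {A : Set M} {n m k : ℕ} {p : Set (L[[A]].Formula (Fin n))}
    {φ : L.Formula (Fin n ⊕ Fin m)} {J : Type w} [LinearOrder J] [Infinite J] {a : J → Fin m → M}
    (h : ∀ S : Finset J, S.card = k → ∃ c : Fin n → M, Realizes L p c ∧
      ∀ j : J, φ.Realize (Sum.elim c (a j)) ↔ j ∈ S) :
    ∃ c : Fin n → M, Realizes L p c ∧ HasAlternations L φ c a (2 * k) := by
  classical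
  obtain ⟨T, hT⟩ := Infinite.exists_subset_card_eq J (2 * k + 1)
  let e := T.orderEmbOfFin hT
  -- Among the positions `0, …, 2 * k` exactly `k` are odd, and selecting these makes the truth
  -- value change at every step.
  let o : Fin k ↪ J := ⟨fun t => e ⟨2 * t + 1, by omega⟩, fun t t' htt => by
    have h1 := Fin.val_eq_of_eq (e.injective htt)
    simp only at h1
    exact Fin.ext (by omega)⟩
  obtain ⟨c, hc, hφ⟩ := h (Finset.univ.map o) (by simp)
  have hodd : ∀ x, φ.Realize (Sum.elim c (a (e x))) ↔ (x : ℕ) % 2 = 1 := by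
    intro x
    rw [hφ]
    simp only [Finset.mem_map, Finset.mem_univ, true_and]
    constructor
    · rintro ⟨t, ht⟩
      have h1 := Fin.val_eq_of_eq (e.injective ht)
      simp only at h1
      omega
    · intro hx
      exact ⟨⟨(x : ℕ) / 2, by omega⟩, congrArg e (Fin.ext (by simp only; omega))⟩
  refine ⟨c, hc, e, fun t => ?_⟩
  rw [hodd, hodd, Fin.val_castSucc, Fin.val_succ]
  omega

end Main
end DpRank

theorem mainTheorem6 (L : FirstOrder.Language.{u, v}) (M : Type w) [L.Structure M]
    (κ : Cardinal.{w}) (hκ : Cardinal.aleph0 < κ) (hM : DpRank.IsSaturated L M κ)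
    (A : Set M) (hA : Cardinal.mk A < κ)
    (n : ℕ) (p : Set (L[[A]].Formula (Fin n))) (hp : DpRank.IsPartialType L p) (k : ℕ) :
    List.TFAE [
      DpRank.DpRankGE L p (k : Cardinal.{w}),
      ∃ (m : ℕ) (φ : L.Formula (Fin n ⊕ Fin m))
        (J : Type w) (_ : LinearOrder J) (_ : Infinite J) (a : J → Fin m → M),
        DpRank.Indiscernible L A a ∧
          ∀ S : Finset J, S.card = k →
            ∃ c : Fin n → M, DpRank.Realizes L p c ∧
              ∀ j : J, φ.Realize (Sum.elim c (a j)) ↔ j ∈ S,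
      ∃ (m : ℕ) (φ : L.Formula (Fin n ⊕ Fin m)), DpRank.AltRankGE L p φ (2 * k)] := by
  tfae_have 1 → 2 := fun h => h.exists_selection hκ hM hA hp
  tfae_have 2 → 3 := by
    rintro ⟨m, φ, J, _, _, a, ha, h⟩
    exact ⟨m, φ, J, _, inferInstance, a, ha, DpRank.hasAlternations_of_selection h⟩
  tfae_have 3 → 1 := by
    rintro ⟨m, φ, h⟩
    exact h.dpRankGE hκ hM hA
  tfae_finish
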